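/- **Setting.** A traffic network consists of $n$ cells, which are the edges of a directed graph; $j$ is an out-neighbor of $i$ if the downstream junction of $i$ is the upstream junction of $j$. A set $\mathcal E_{\rm on}$ of cells (on-ramps) have no in-neighbors and a set $\mathcal E_{\rm off}$ of cells (off-ramps) have no out-neighbors. Each cell $i$ has a length $\ell_i>0$, a free-flow speed $v_i>0$, a congestion wave speed $w_i>0$, a capacity $C_i\ge 0$ and a jam density $\gamma_i\in(0,\infty]$, with $\gamma_i=\infty$ for $i\in\mathcal E_{\rm on}$; the sampling period $T_s>0$ satisfies $v_iT_s\le\ell_i$ and $w_iT_s\le\ell_i$ for all $i$. The split ratios $R^k_{ij}\in[0,1]$ (possibly time-varying, known in advance) satisfy $\sum_jR^k_{ij}=1$ for $i\notin\mathcal E_{\rm off}$, and $R^k_{ij}=0$ if $i=j$ or $j$ is not an out-neighbor of $i$. With traffic masses $x_i^k$, outflow rates $u_i^k$, inflow rates $y_i^k$ and exogenous inflow rates $\lambda_i^k$ (zero for $i\notin\mathcal E_{\rm on}$), the network model is $$x_i^{k+1}=x_i^k+T_s(y_i^k-u_i^k),\qquad y_i^k=\lambda_i^k+\sum_{j=1}^nR^k_{ji}u_j^k,$$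 $$0\le u_i^k\le\min\{(v_i/\ell_i)x_i^k,\,C_i\},\qquad 0\le y_i^k\le\min\{w_i(\gamma_i-x_i^k/\ell_i),\,C_i\}$$ for $k=0,\dots,N-1$ and all $i$ (if $\gamma_i=\infty$, the last bound is just $y_i^k\le C_i$). Given a horizon $N$ and weights $\alpha_i^k\ge0$, $\beta_i^k\in\mathbb R$, the cost on $[k,N]$ is $$J^{[k,N]}=\sum_i\alpha_i^Nx_i^N+\sum_{j=k}^{N-1}\sum_i(\alpha_i^jx_i^j+\beta_i^ju_i^j).$$ Let $\mathcal X^k$ be the set of states from which the problem of minimizing $J^{[k,N]}$ subject to the network model with $\lambda=0$ is feasible. A *zero-$\lambda$ optimal control law* is a static state feedback $u^k=\phi^k(x^k)$, $0\le k<N$, such that, for every $k<N$ and every $x\in\mathcal X^k$, the closed loop with $\lambda=0$ started from $x$ at time $k$ is an optimal solution of this problem on $[k,N]$. **Statement.** 1. There is a zero-$\lambda$ optimal control law of the form $$\phi^k(x)=F_i^kx+f_i^k\quad\text{if }x\in\mathcal R_i^k=\{x\in\mathbb R^n: H_i^kx\le h_i^k\},\qquad i=1,\dots,p^k,$$ where,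 for each $k<N$, $\phi^k$ is continuous on $\mathcal X^k$, and $\mathcal R^k_1,\dots,\mathcal R^k_{p^k}$ is a finite polyhedral partition of $\mathcal X^k$ (their union is $\mathcal X^k$ and their interiors are pairwise disjoint). The matrices and vectors $F_i^k,f_i^k,H_i^k,h_i^k$ can be fixed off-line: they depend only on the network parameters, the weights and $N$, not on the states or on the actual exogenous inflows. 2. Let $\phi$ be any zero-$\lambda$ optimal control law, let $\lambda$ be any exogenous inflow with $0\le\lambda_i^k\le C_i$ for $i\in\mathcal E_{\rm on}$ and $\lambda_i^k=0$ for $i\notin\mathcal E_{\rm on}$ ($0\le k<N$), and let $x^0$ be any initial state with $0\le x_i^0\le\ell_i\gamma_i$ for all $i$. Then the trajectory of the network with inflow $\lambda$ under $u^k=\phi^k(x^k)$ satisfies all constraints of the network model for $k=0,\dots,N-1$. -/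

import Mathlib

/-- A cell-transmission traffic network with cells `Fin n` and junctions `V`. Each cell is a
directed edge from its upstream junction `tail` to its downstream junction `head`. -/
structure TrafficNetwork (n : ℕ) (V : Type*) where
  tail : Fin n → V
  head : Fin n → V
  /-- the source set -/
  onRamps : Set (Fin n)
  /-- the sink set -/
  offRamps : Set (Fin n)
  /-- on-ramps have no in-neighbors -/
  no_inNbr_onRamp : ∀ i ∈ onRamps, ∀ j, head j ≠ tail i
  /-- off-ramps have no out-neighbors -/
  no_outNbr_offRamp : ∀ i ∈ offRamps, ∀ j, head i ≠ tail j
  /-- the sampling period `T_s` -/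
  Ts : ℝ
  /-- the length `ℓ i` of a cell -/
  len : Fin n → ℝ
  /-- the free-flow speed `v i` -/
  freeSpeed : Fin n → ℝ
  /-- the backward congestion wave speed `w i` -/
  waveSpeed : Fin n → ℝ
  /-- the maximum flow capacity `C i` -/
  capacity : Fin n → ℝ
  /-- the jam density `γ i`, which may be infinite -/
  jamDensity : Fin n → EReal
  Ts_pos : 0 < Ts
  len_pos : ∀ i, 0 < len i
  freeSpeed_pos : ∀ i, 0 < freeSpeed i
  waveSpeed_pos : ∀ i, 0 < waveSpeed i
  capacity_nonneg : ∀ i, 0 ≤ capacity i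
  jamDensity_pos : ∀ i, 0 < jamDensity i
  jamDensity_onRamp : ∀ i ∈ onRamps, jamDensity i = ⊤
  /-- Courant-Friedrichs-Lewy condition, forward direction -/
  cfl_forward : ∀ i, freeSpeed i * Ts ≤ len i
  /-- Courant-Friedrichs-Lewy condition, backward direction -/
  cfl_backward : ∀ i, waveSpeed i * Ts ≤ len i
  /-- `splitRatio k i j` is the fraction at time `k` of the flow leaving `i` that enters `j` -/
  splitRatio : ℕ → Fin n → Fin n → ℝ
  splitRatio_mem : ∀ k i j, splitRatio k i j ∈ Set.Icc (0 : ℝ) 1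
  splitRatio_sum : ∀ k, ∀ i ∉ offRamps, ∑ j, splitRatio k i j = 1
  splitRatio_self : ∀ k i, splitRatio k i i = 0
  splitRatio_not_adj : ∀ k i j, head i ≠ tail j → splitRatio k i j = 0

namespace TrafficNetwork

variable {n : ℕ} {V : Type*} (net : TrafficNetwork n V)

/-- The inflow rates `y` at time `k` for exogenous inflows `lam` and outflow rates `u`. -/
def inflow (k : ℕ) (lam u : Fin n → ℝ) (i : Fin n) : ℝ :=
  lam i + ∑ j, net.splitRatio k j i * u j

/-- One step of the dynamics of the traffic masses. -/
def step (k : ℕ) (lam x u : Fin n → ℝ) (i : Fin n) : ℝ :=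
  x i + net.Ts * (net.inflow k lam u i - u i)

/-- The demand and supply constraints at time `k`. The supply constraint is read in the extended
reals, so that an infinite jam density leaves only the capacity bound. -/
def Constraints (k : ℕ) (lam x u : Fin n → ℝ) : Prop :=
  ∀ i, (0 ≤ u i ∧ u i ≤ min (net.freeSpeed i / net.len i * x i) (net.capacity i)) ∧
    (0 ≤ net.inflow k lam u i ∧
      (net.inflow k lam u i : EReal) ≤
        min ((net.waveSpeed i : EReal) *
            (net.jamDensity i - ((1 / net.len i * x i : ℝ) : EReal)))
          (net.capacity i : EReal))

/-- The states `x` and outflows `u` satisfy the network model on the horizon `[k, N]` with exogenous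
inflows `lam`, starting from the state `x0` at time `k`. -/
def IsFeasible (lam : ℕ → Fin n → ℝ) (k N : ℕ) (x0 : Fin n → ℝ) (x u : ℕ → Fin n → ℝ) : Prop :=
  x k = x0 ∧ ∀ j, k ≤ j → j < N →
    x (j + 1) = net.step j (lam j) (x j) (u j) ∧ net.Constraints j (lam j) (x j) (u j)

/-- The set of states from which the problem on `[k, N]` is feasible. -/
def feasibleStates (lam : ℕ → Fin n → ℝ) (k N : ℕ) : Set (Fin n → ℝ) :=
  {x0 | ∃ x u, net.IsFeasible lam k N x0 x u}

/-- The linear performance index on `[k, N]`. -/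
def cost (α β : ℕ → Fin n → ℝ) (k N : ℕ) (x u : ℕ → Fin n → ℝ) : ℝ :=
  ∑ i, α N i * x N i + ∑ j ∈ Finset.Ico k N, ∑ i, (α j i * x j i + β j i * u j i)

/-- `(x, u)` solves the optimal control problem on `[k, N]` from the state `x0`. -/
def IsOptimal (α β lam : ℕ → Fin n → ℝ) (k N : ℕ) (x0 : Fin n → ℝ)
    (x u : ℕ → Fin n → ℝ) : Prop :=
  net.IsFeasible lam k N x0 x u ∧
    ∀ x' u', net.IsFeasible lam k N x0 x' u' → cost α β k N x u ≤ cost α β k N x' u'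

/-- The states (at absolute times `j ≥ k`) of the network under the static state feedback
`u^j = φ j (x^j)`, started from `x0` at time `k`. -/
def closedLoop (lam : ℕ → Fin n → ℝ) (φ : ℕ → (Fin n → ℝ) → (Fin n → ℝ)) (k : ℕ)
    (x0 : Fin n → ℝ) : ℕ → Fin n → ℝ
  | 0 => x0
  | j + 1 =>
    if k ≤ j then
      net.step j (lam j) (closedLoop lam φ k x0 j) (φ j (closedLoop lam φ k x0 j))
    else x0

/-- `φ` is an optimal static state-feedback law on the horizon `[0, N]` for the network with all
exogenous inflows zero: from every time `k` and every state that is feasible at time `k`, the closed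
loop is an optimal solution on the remaining horizon `[k, N]`. -/
def IsZeroInflowOptimalLaw (α β : ℕ → Fin n → ℝ) (N : ℕ)
    (φ : ℕ → (Fin n → ℝ) → (Fin n → ℝ)) : Prop :=
  ∀ k < N, ∀ x0 ∈ net.feasibleStates 0 k N,
    net.IsOptimal α β 0 k N x0 (net.closedLoop 0 φ k x0)
      (fun j => φ j (net.closedLoop 0 φ k x0 j))

/-- Exogenous inflows enter through on-ramps only, are nonnegative, and respect the capacity. -/
def AdmissibleInflow (N : ℕ) (lam : ℕ → Fin n → ℝ) : Prop :=
  ∀ k < N, ∀ i, 0 ≤ lam k i ∧ lam k i ≤ net.capacity i ∧ (i ∉ net.onRamps → lam k i = 0)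

/-- Traffic masses that are nonnegative and for which no density exceeds the jam density. -/
def AdmissibleState (x : Fin n → ℝ) : Prop :=
  ∀ i, 0 ≤ x i ∧ ((x i / net.len i : ℝ) : EReal) ≤ net.jamDensity i

end TrafficNetwork

/-- The convex polyhedron `{x | H x ≤ h}`. -/
def polyhedron {m n : ℕ} (H : Matrix (Fin m) (Fin n) ℝ) (h : Fin m → ℝ) : Set (Fin n → ℝ) :=
  {x | H.mulVec x ≤ h}

/-- `g` is piecewise affine on `X`: there is a finite polyhedral partition of `X` (closed polyhedra
with union `X` and pairwise disjoint interiors) on each member of which `g` is affine. -/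
def IsPiecewiseAffineOn {n : ℕ} (g : (Fin n → ℝ) → (Fin n → ℝ)) (X : Set (Fin n → ℝ)) : Prop :=
  ∃ (p : ℕ) (m : Fin p → ℕ) (H : ∀ i, Matrix (Fin (m i)) (Fin n) ℝ) (h : ∀ i, Fin (m i) → ℝ)
    (F : Fin p → Matrix (Fin n) (Fin n) ℝ) (f : Fin p → Fin n → ℝ),
    (⋃ i, polyhedron (H i) (h i)) = X ∧
    (∀ i j, i ≠ j →
      Disjoint (interior (polyhedron (H i) (h i))) (interior (polyhedron (H j) (h j)))) ∧
    ∀ i, ∀ x ∈ polyhedron (H i) (h i), g x = (F i).mulVec x + f i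

/-! On a fixed horizon the problem is a linear program in the outflows, which lie in a capacity box,
and the initial state enters as a parameter of a polyhedral feasible set. Minimizers need not be
unique, and a careless choice among them need not be continuous. So the cost is perturbed to a
generic one (`exists_generic_cost`) whose minimizer is unique and still minimizes the original cost.
Sets of active constraints then give finitely many affine formulas on closed polyhedra, and
uniqueness makes them agree on overlaps (`exists_minimizer_hasAffineCover`); this yields continuity.
Cutting along all bounding hyperplanes yields a partition (`HasAffineCover.isPiecewiseAffineOn`).
The first moves of these minimizers form an optimal feedback by dynamic programming
(`isOptimal_closedLoop`).

For the second claim only feasibility of the law matters. Zero outflow is feasible from every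
admissible state, so there the law obeys the zero-inflow constraints. Exogenous inflow changes only
the inflow of on-ramps, which have no in-neighbors and infinite jam density, so the same outflow
remains valid (`Constraints.of_zero_inflow`). The Courant-Friedrichs-Lewy conditions make the next
state admissible (`AdmissibleState.step`), and induction on time concludes. -/

/-- A finite intersection of closed half-spaces. -/
def IsPolyhedral {W : Type*} [AddCommGroup W] [Module ℝ W] (S : Set W) : Prop :=
  ∃ (ι : Type) (_ : Fintype ι) (a : ι → W →ₗ[ℝ] ℝ) (b : ι → ℝ), S = {x | ∀ i, a i x ≤ b i}

/-- `D` is a finite union of polyhedra on each of which `g` is affine. -/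
def HasAffineCover {X E : Type*} [AddCommGroup X] [Module ℝ X] [AddCommGroup E] [Module ℝ E]
    (g : X → E) (D : Set X) : Prop :=
  ∃ (κ : Type) (_ : Fintype κ) (R : κ → Set X) (F : κ → X →ₗ[ℝ] E) (f : κ → E),
    (∀ k, IsPolyhedral (R k)) ∧ (⋃ k, R k) = D ∧ ∀ k, ∀ x ∈ R k, g x = F k x + f k

/-! ### Closure properties of polyhedra. -/

namespace IsPolyhedral

variable {W W' : Type*} [AddCommGroup W] [Module ℝ W] [AddCommGroup W'] [Module ℝ W']

theorem halfSpace (a : W →ₗ[ℝ] ℝ) (b : ℝ) : IsPolyhedral {x | a x ≤ b} :=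
  ⟨Unit, inferInstance, fun _ => a, fun _ => b, by simp⟩

theorem inter {S T : Set W} (hS : IsPolyhedral S) (hT : IsPolyhedral T) :
    IsPolyhedral (S ∩ T) := by
  obtain ⟨ι, _, a, b, rfl⟩ := hS
  obtain ⟨κ, _, a', b', rfl⟩ := hT
  refine ⟨ι ⊕ κ, inferInstance, Sum.elim a a', Sum.elim b b', ?_⟩
  ext x
  simp

theorem iInter {κ : Type} [Fintype κ] {S : κ → Set W} (hS : ∀ k, IsPolyhedral (S k)) :
    IsPolyhedral (⋂ k, S k) := by
  choose ι hι a b h using hS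
  refine ⟨Σ k, ι k, inferInstance, fun p => a p.1 p.2, fun p => b p.1 p.2, ?_⟩
  ext x
  simp only [h, Set.mem_iInter, Set.mem_ofPred_eq, Sigma.forall]

theorem preimage {S : Set W} (hS : IsPolyhedral S) (f : W' →ₗ[ℝ] W) :
    IsPolyhedral (f ⁻¹' S) := by
  obtain ⟨ι, _, a, b, rfl⟩ := hS
  exact ⟨ι, inferInstance, fun i => a i ∘ₗ f, b, rfl⟩

theorem isClosed {W : Type*} [NormedAddCommGroup W] [NormedSpace ℝ W] [FiniteDimensional ℝ W]
    {S : Set W} (hS : IsPolyhedral S) : IsClosed S := by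
  obtain ⟨ι, _, a, b, rfl⟩ := hS
  simp only [Set.ofPred_forall]
  exact isClosed_iInter fun i =>
    isClosed_le (a i).continuous_of_finiteDimensional continuous_const

end IsPolyhedral

/-! ### Linear programming duality and generic costs. -/

/-- **Farkas' lemma**. -/
theorem farkas {ι W : Type*} [AddCommGroup W] [Module ℝ W] (s : Finset ι)
    (a : ι → W →ₗ[ℝ] ℝ) (c : W →ₗ[ℝ] ℝ) (h : ∀ x, (∀ i ∈ s, a i x ≤ 0) → c x ≤ 0) :
    ∃ y : ι → ℝ, (∀ i, 0 ≤ y i) ∧ c = ∑ i ∈ s, y i • a i := by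
  classical
  induction s using Finset.induction_on generalizing a c with
  | empty =>
    refine ⟨0, fun _ => le_rfl, LinearMap.ext fun x => ?_⟩
    have h1 := h x (by simp)
    have h2 := h (-x) (by simp)
    rw [map_neg] at h2
    simp only [Finset.sum_empty, LinearMap.zero_apply]
    linarith
  | insert j s hj ih =>
    by_cases hs : ∀ x, (∀ i ∈ s, a i x ≤ 0) → c x ≤ 0
    · obtain ⟨y, hy, hc⟩ := ih a c hs
      refine ⟨Function.update y j 0, fun i => ?_, ?_⟩
      · rcases eq_or_ne i j with rfl | hi
        · simp
        · simpa [hi] using hy i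
      · rw [Finset.sum_insert hj, Function.update_self, zero_smul, zero_add, hc]
        exact Finset.sum_congr rfl fun i hi => by
          rw [Function.update_of_ne (ne_of_mem_of_not_mem hi hj)]
    · push Not at hs
      obtain ⟨x₀, hx₀, hcx₀⟩ := hs
      have hjx₀ : 0 < a j x₀ := by
        by_contra hneg
        exact absurd (h x₀ (Finset.forall_mem_insert _ _ _ |>.2 ⟨not_lt.1 hneg, hx₀⟩))
          (not_le.2 hcx₀)
      -- With `a j v = 1`, the map `x ↦ x - a j x • v` projects onto the kernel of `a j`. The
      -- induction hypothesis is applied to the functionals composed with this projection; the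
      -- constraint `j` then holds automatically.
      set v : W := (a j x₀)⁻¹ • x₀ with hv
      have hjv : a j v = 1 := by rw [hv, map_smul, smul_eq_mul, inv_mul_cancel₀ hjx₀.ne']
      have hav : ∀ i ∈ s, a i v ≤ 0 := fun i hi => by
        rw [hv, map_smul, smul_eq_mul]
        exact mul_nonpos_of_nonneg_of_nonpos (inv_nonneg.2 hjx₀.le) (hx₀ i hi)
      have hcv : 0 < c v := by
        rw [hv, map_smul, smul_eq_mul]
        exact mul_pos (inv_pos.2 hjx₀) hcx₀
      obtain ⟨y, hy, hc⟩ := ih (fun i => a i - a i v • a j) (c - c v • a j) (fun x hx => by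
        have := h (x - a j x • v) (Finset.forall_mem_insert _ _ _ |>.2 ⟨by simp [hjv], fun i hi => by
          have := hx i hi
          simp only [LinearMap.sub_apply, LinearMap.smul_apply, smul_eq_mul] at this
          simp only [map_sub, map_smul, smul_eq_mul]
          linarith⟩)
        simp only [map_sub, map_smul, smul_eq_mul] at this
        simp only [LinearMap.sub_apply, LinearMap.smul_apply, smul_eq_mul]
        linarith)
      have hsum : ∑ i ∈ s, y i * a i v ≤ 0 := Finset.sum_nonpos fun i hi =>
        mul_nonpos_of_nonneg_of_nonpos (hy i) (hav i hi)
      -- This multiplier is forced by evaluating the desired identity at `v`; it is nonnegative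
      -- because `c v > 0` and `a i v ≤ 0` on `s`.
      refine ⟨Function.update y j (c v - ∑ i ∈ s, y i * a i v), fun i => ?_, ?_⟩
      · rcases eq_or_ne i j with rfl | hi
        · simp only [Function.update_self]; linarith
        · simpa [hi] using hy i
      · have hcongr : ∑ i ∈ s, Function.update y j (c v - ∑ i ∈ s, y i * a i v) i • a i =
            ∑ i ∈ s, y i • a i := Finset.sum_congr rfl fun i hi => by
          rw [Function.update_of_ne (ne_of_mem_of_not_mem hi hj)]
        rw [Finset.sum_insert hj, Function.update_self, hcongr]
        refine LinearMap.ext fun x => ?_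
        have := LinearMap.congr_fun hc x
        simp only [LinearMap.sub_apply, LinearMap.smul_apply, smul_eq_mul,
          LinearMap.sum_apply, mul_sub, Finset.sum_sub_distrib] at this
        simp only [LinearMap.add_apply, LinearMap.smul_apply, smul_eq_mul, LinearMap.sum_apply,
          sub_mul, Finset.sum_mul]
        simp only [← mul_assoc] at this ⊢
        linarith

/-- The first-order optimality condition of linear programming: the cost is a nonnegative
combination of the normals of the active constraints. -/
theorem exists_multipliers_of_isMinimizer {ι E : Type*} [Fintype ι] [AddCommGroup E] [Module ℝ E]
    (a : ι → E →ₗ[ℝ] ℝ) (r : ι → ℝ) (c : E →ₗ[ℝ] ℝ) {z : E} (hz : ∀ i, a i z ≤ r i)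
    (hmin : ∀ z', (∀ i, a i z' ≤ r i) → c z ≤ c z') :
    ∃ (J : Finset ι) (y : ι → ℝ), (∀ j ∈ J, a j z = r j) ∧ (∀ j ∈ J, 0 < y j) ∧
      -c = ∑ j ∈ J, y j • a j := by
  classical
  -- A direction that increases no active constraint is feasible for a short step, since inactive
  -- constraints have slack; minimality then bounds `c` below along it.
  obtain ⟨y, hy, hc⟩ := farkas (Finset.univ.filter fun i => a i z = r i) a (-c) (fun v hv => by
    have hev : ∀ᶠ t : ℝ in nhdsWithin 0 (Set.Ioi 0), ∀ i, a i (z + t • v) ≤ r i := by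
      refine Filter.eventually_all.2 fun i => ?_
      rcases (hz i).eq_or_lt with hi | hi
      · filter_upwards [self_mem_nhdsWithin] with t ht
        have := mul_nonpos_of_nonneg_of_nonpos (le_of_lt ht) (hv i (by simp [hi]))
        rw [map_add, map_smul, smul_eq_mul]
        linarith
      · have hcont : Continuous fun t : ℝ => a i (z + t • v) := by
          simp only [map_add, map_smul, smul_eq_mul]
          fun_prop
        have : ∀ᶠ t : ℝ in nhds 0, a i (z + t • v) < r i :=
          hcont.tendsto 0 |>.eventually (gt_mem_nhds (by simpa using hi))
        exact (this.filter_mono nhdsWithin_le_nhds).mono fun t ht => ht.le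
    obtain ⟨t, ht, htpos⟩ := (hev.and self_mem_nhdsWithin).exists
    have h1 := hmin _ ht
    rw [map_add, map_smul, smul_eq_mul] at h1
    have h2 : 0 ≤ c v := nonneg_of_mul_nonneg_right (by linarith : 0 ≤ t * c v) htpos
    simpa using h2)
  -- Zero multipliers are dropped: strict positivity is what later gives uniqueness.
  refine ⟨(Finset.univ.filter fun i => a i z = r i).filter fun i => y i ≠ 0, y, ?_, ?_, ?_⟩
  · intro j hj
    simp only [Finset.mem_filter] at hj
    exact hj.1.2
  · intro j hj
    simp only [Finset.mem_filter] at hj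
    exact (hy j).lt_of_ne' hj.2
  · rw [hc]
    symm
    refine Finset.sum_filter_of_ne fun i _ hi h0 => hi (by rw [h0, zero_smul])

/-- A linear cost can be perturbed so that it avoids the span of every non-spanning subfamily
of `a`, and lies only in those cones generated by subfamilies that contain the original cost. -/
theorem exists_generic_cost {ι E : Type*} [Fintype ι] [AddCommGroup E] [Module ℝ E]
    (a : ι → E →ₗ[ℝ] ℝ) (c : E →ₗ[ℝ] ℝ) :
    ∃ c' : E →ₗ[ℝ] ℝ, ∀ (J : Finset ι) (y : ι → ℝ), (∀ j ∈ J, 0 ≤ y j) →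
      -c' = ∑ j ∈ J, y j • a j →
      Submodule.span ℝ (a '' (J : Set ι)) = ⊤ ∧
        ∃ y' : ι → ℝ, (∀ j, 0 ≤ y' j) ∧ -c = ∑ j ∈ J, y' j • a j := by
  classical
  -- A real vector space is not a finite union of proper subspaces.
  obtain ⟨d, hd⟩ : ∃ d : E →ₗ[ℝ] ℝ, ∀ J : Finset ι, Submodule.span ℝ (a '' (J : Set ι)) ≠ ⊤ →
      d ∉ Submodule.span ℝ (a '' (J : Set ι)) := by
    have := Subspace.biUnion_ne_univ_of_top_notMem
      (s := (Finset.univ.image fun J : Finset ι => Submodule.span ℝ (a '' (J : Set ι))).erase ⊤)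
      (by simp)
    obtain ⟨d, hd⟩ := (Set.ne_univ_iff_exists_notMem _).1 this
    refine ⟨d, fun J hJ hdJ => hd ?_⟩
    simp only [Set.mem_iUnion]
    exact ⟨_, Finset.mem_erase.2 ⟨hJ, Finset.mem_image_of_mem _ (Finset.mem_univ J)⟩, hdJ⟩
  have h1 : ∀ᶠ t : ℝ in nhdsWithin 0 (Set.Ioi 0), ∀ J : Finset ι,
      Submodule.span ℝ (a '' (J : Set ι)) ≠ ⊤ → c + t • d ∉ Submodule.span ℝ (a '' (J : Set ι)) := by
    refine Filter.eventually_all.2 fun J => ?_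
    by_cases hJ : Submodule.span ℝ (a '' (J : Set ι)) = ⊤
    · simp [hJ]
    -- Two points of the line in the span would put `d` there, so each span excludes at most one
    -- `t`.
    have hsub : {t : ℝ | c + t • d ∈ Submodule.span ℝ (a '' (J : Set ι))}.Subsingleton := by
      intro t ht t' ht'
      by_contra hne
      refine hd J hJ ?_
      have h3 : (c + t • d) - (c + t' • d) ∈ Submodule.span ℝ (a '' (J : Set ι)) :=
        Submodule.sub_mem _ ht ht'
      rw [add_sub_add_left_eq_sub, ← sub_smul t t' d] at h3
      exact (Submodule.smul_mem_iff _ (sub_ne_zero.2 hne)).1 h3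
    by_cases h0 : ∃ t₀ : ℝ, 0 < t₀ ∧ c + t₀ • d ∈ Submodule.span ℝ (a '' (J : Set ι))
    · obtain ⟨t₀, ht₀, hmem⟩ := h0
      filter_upwards [Ioo_mem_nhdsGT ht₀] with t ht _ htmem
      exact ht.2.ne (hsub htmem hmem)
    · push Not at h0
      filter_upwards [self_mem_nhdsWithin] with t ht _
      exact h0 t ht
  have h2 : ∀ᶠ t : ℝ in nhdsWithin 0 (Set.Ioi 0), ∀ J : Finset ι,
      (∃ y : ι → ℝ, (∀ j ∈ J, 0 ≤ y j) ∧ -(c + t • d) = ∑ j ∈ J, y j • a j) →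
        ∃ y' : ι → ℝ, (∀ j, 0 ≤ y' j) ∧ -c = ∑ j ∈ J, y' j • a j := by
    refine Filter.eventually_all.2 fun J => ?_
    by_cases hJ : ∃ y' : ι → ℝ, (∀ j, 0 ≤ y' j) ∧ -c = ∑ j ∈ J, y' j • a j
    · exact Filter.Eventually.of_forall fun _ _ => hJ
    -- If `-c` is outside the cone of `J`, Farkas gives a strictly separating vector, which still
    -- separates after a small perturbation.
    have hv : ∃ v, (∀ j ∈ J, a j v ≤ 0) ∧ 0 < (-c) v := by
      by_contra hcon
      push Not at hcon
      exact hJ (farkas J a (-c) hcon)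
    obtain ⟨v, hv, hcv⟩ := hv
    have hcont : Continuous fun t : ℝ => (-(c + t • d)) v := by
      simp only [LinearMap.neg_apply, LinearMap.add_apply, LinearMap.smul_apply, smul_eq_mul]
      fun_prop
    have : ∀ᶠ t : ℝ in nhds 0, 0 < (-(c + t • d)) v :=
      hcont.tendsto 0 |>.eventually (lt_mem_nhds (by simpa using hcv))
    refine (this.filter_mono nhdsWithin_le_nhds).mono fun t ht ⟨y, hy, hsum⟩ => ?_
    rw [hsum, LinearMap.sum_apply] at ht
    refine absurd ht (not_lt.2 (Finset.sum_nonpos fun j hj => ?_))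
    exact mul_nonpos_of_nonneg_of_nonpos (hy j hj) (hv j hj)
  obtain ⟨t, ht1, ht2⟩ := (h1.and h2).exists
  refine ⟨c + t • d, fun J y hy hsum => ⟨?_, ht2 J ⟨y, hy, hsum⟩⟩⟩
  by_contra hJ
  refine ht1 J hJ ?_
  rw [← Submodule.neg_mem_iff, hsum]
  exact Submodule.sum_mem _ fun j hj =>
    Submodule.smul_mem _ _ (Submodule.subset_span (Set.mem_image_of_mem _ hj))

/-! ### Parametric linear programs. -/

/-- A multiparametric linear program with bounded sections has a selection of minimizers that is
piecewise affine on the set of feasible parameters. -/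
theorem exists_minimizer_hasAffineCover {X E : Type*} [AddCommGroup X] [Module ℝ X]
    [NormedAddCommGroup E] [NormedSpace ℝ E] [FiniteDimensional ℝ E] {P : Set (X × E)}
    (hP : IsPolyhedral P) (hb : ∀ x, Bornology.IsBounded {z | (x, z) ∈ P}) (c : E →ₗ[ℝ] ℝ) :
    ∃ g : X → E, (∀ x ∈ Prod.fst '' P, (x, g x) ∈ P ∧ ∀ z, (x, z) ∈ P → c (g x) ≤ c z) ∧
      HasAffineCover g (Prod.fst '' P) := by
  classical
  obtain ⟨ι, _, A, b, rfl⟩ := hP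
  set P : Set (X × E) := {x | ∀ i, A i x ≤ b i} with hPdef
  set a : ι → E →ₗ[ℝ] ℝ := fun i => A i ∘ₗ LinearMap.inr ℝ X E with ha
  set q : ι → X →ₗ[ℝ] ℝ := fun i => -(A i ∘ₗ LinearMap.inl ℝ X E) with hq
  have hA : ∀ i x z, A i (x, z) = a i z - q i x := fun i x z => by
    have : ((x, z) : X × E) = (x, 0) + (0, z) := by simp
    rw [this, map_add]
    simp [ha, hq, add_comm]
  have hmem : ∀ x z, (x, z) ∈ P ↔ ∀ i, a i z ≤ q i x + b i := fun x z => by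
    simp only [hPdef, Set.mem_ofPred_eq, hA]
    exact forall_congr' fun i => by rw [sub_le_iff_le_add']
  obtain ⟨c', hc'⟩ := exists_generic_cost a c
  have hT : ∀ J : Finset ι, Submodule.span ℝ (a '' (J : Set ι)) = ⊤ →
      ∃ T : (J → ℝ) →ₗ[ℝ] E, ∀ z, T (fun j => a j z) = z := by
    intro J hJ
    -- Functionals that span the dual separate points, so `z` is recovered linearly from the values
    -- `a j z`.
    have hker : LinearMap.ker (LinearMap.pi fun j : J => a j) = ⊥ := by
      rw [LinearMap.ker_eq_bot']
      intro z hz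
      rw [← Module.forall_dual_apply_eq_zero_iff ℝ]
      intro f
      have hf : f ∈ Submodule.span ℝ (a '' (J : Set ι)) := hJ ▸ Submodule.mem_top
      induction hf using Submodule.span_induction with
      | mem f hf =>
        obtain ⟨j, hj, rfl⟩ := hf
        exact congr_fun hz ⟨j, hj⟩
      | zero => simp
      | add f g _ _ hf hg => simp [hf, hg]
      | smul t f _ hf => simp [hf]
    obtain ⟨T, hT⟩ := LinearMap.exists_leftInverse_of_injective _ hker
    exact ⟨T, fun z => LinearMap.congr_fun hT z⟩
  -- Dual feasibility does not involve the parameter `x`, so one finite index set serves all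
  -- parameters.
  let κ := {J : Finset ι // ∃ y : ι → ℝ, (∀ j ∈ J, 0 < y j) ∧ -c' = ∑ j ∈ J, y j • a j}
  have hκ : ∀ J : κ, ∃ T : (J.1 → ℝ) →ₗ[ℝ] E, ∀ z, T (fun j => a j z) = z := fun J => by
    obtain ⟨y, hy, hsum⟩ := J.2
    exact hT J.1 (hc' J.1 y (fun j hj => (hy j hj).le) hsum).1
  choose T hT using hκ
  let F : κ → X →ₗ[ℝ] E := fun J => T J ∘ₗ LinearMap.pi fun j : J.1 => q j
  let f : κ → E := fun J => T J fun j : J.1 => b j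
  have hFf : ∀ J x, F J x + f J = T J fun j : J.1 => q j x + b j := fun J x => by
    simp only [F, f, LinearMap.comp_apply, ← map_add]
    rfl
  -- `J` may be overdetermined and `T J` is only a left inverse, so activity of the constraints in
  -- `J` has to be imposed in addition to feasibility.
  let R : κ → Set X := fun J =>
    {x | (∀ i, a i (F J x + f J) ≤ q i x + b i) ∧ ∀ j : J.1, q j x + b j ≤ a j (F J x + f J)}
  have hR : ∀ J, IsPolyhedral (R J) := fun J => by
    have h1 : IsPolyhedral (⋂ i, {x | (a i ∘ₗ F J - q i) x ≤ b i - a i (f J)}) :=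
      IsPolyhedral.iInter fun i => IsPolyhedral.halfSpace _ _
    have h2 : IsPolyhedral (⋂ j : J.1, {x | (q j - a j ∘ₗ F J) x ≤ a j (f J) - b j}) :=
      IsPolyhedral.iInter fun i => IsPolyhedral.halfSpace _ _
    convert h1.inter h2 using 1
    ext x
    simp only [R, map_add, Set.mem_ofPred_eq, Set.mem_inter_iff, Set.mem_iInter,
      LinearMap.sub_apply, LinearMap.comp_apply]
    refine and_congr (forall_congr' fun i => ?_) (forall_congr' fun i => ?_) <;>
    constructor <;> intro h <;> linarith
  have hactive : ∀ J x, x ∈ R J → ∀ j ∈ J.1, a j (F J x + f J) = q j x + b j :=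
    fun J x hx j hj => le_antisymm (hx.1 j) (hx.2 ⟨j, hj⟩)
  -- Weak duality for the original cost: its multipliers live on the same active set `J`.
  have hmin : ∀ J x, x ∈ R J → ∀ z, (x, z) ∈ P → c (F J x + f J) ≤ c z := by
    intro J x hx z hz
    obtain ⟨y, hy, hsum⟩ := J.2
    obtain ⟨y', hy', hsum'⟩ := (hc' J.1 y (fun j hj => (hy j hj).le) hsum).2
    have h1 : (-c) z ≤ (-c) (F J x + f J) := by
      rw [hsum', LinearMap.sum_apply, LinearMap.sum_apply]
      refine Finset.sum_le_sum fun j hj => ?_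
      simp only [LinearMap.smul_apply, smul_eq_mul]
      rw [hactive J x hx j hj]
      exact mul_le_mul_of_nonneg_left ((hmem x z).1 hz j) (hy' j)
    simpa using h1
  -- Complementary slackness: positive multipliers of `c'` force every competitor to be active on
  -- all of `J`, and those values determine it.
  have huniq : ∀ J x, x ∈ R J → ∀ z, (x, z) ∈ P → c' z ≤ c' (F J x + f J) →
      z = F J x + f J := by
    intro J x hx z hz hle
    obtain ⟨y, hy, hsum⟩ := J.2
    have h1 : (-c') (F J x + f J) ≤ (-c') z := by simpa using hle
    rw [hsum, LinearMap.sum_apply, LinearMap.sum_apply] at h1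
    simp only [LinearMap.smul_apply, smul_eq_mul] at h1
    have h2 : ∀ j ∈ J.1, y j * a j z ≤ y j * a j (F J x + f J) := fun j hj => by
      rw [hactive J x hx j hj]
      exact mul_le_mul_of_nonneg_left ((hmem x z).1 hz j) (hy j hj).le
    have h3 := (Finset.sum_eq_sum_iff_of_le h2).1 (le_antisymm (Finset.sum_le_sum h2) h1)
    rw [← hT J z, hFf]
    congr 1
    funext j
    rw [← hactive J x hx j j.2]
    exact mul_left_cancel₀ (hy j j.2).ne' (h3 j j.2)
  have hcover : ∀ x ∈ Prod.fst '' P, ∃ J, x ∈ R J := by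
    rintro _ ⟨⟨x, z₀⟩, hz₀, rfl⟩
    have hclosed : IsClosed {z | (x, z) ∈ P} := by
      simp only [hmem, Set.ofPred_forall]
      exact isClosed_iInter fun i =>
        isClosed_le (a i).continuous_of_finiteDimensional continuous_const
    have := FiniteDimensional.proper ℝ E
    obtain ⟨z, hz, hzmin⟩ := (Metric.isCompact_of_isClosed_isBounded hclosed (hb x)).exists_isMinOn
      ⟨z₀, hz₀⟩ c'.continuous_of_finiteDimensional.continuousOn
    obtain ⟨J, y, hJ, hy, hsum⟩ := exists_multipliers_of_isMinimizer a (fun i => q i x + b i) c'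
      ((hmem x z).1 hz) (fun z' hz' => hzmin ((hmem x z').2 hz'))
    refine ⟨⟨J, y, hy, hsum⟩, ?_⟩
    have hzJ : F ⟨J, y, hy, hsum⟩ x + f ⟨J, y, hy, hsum⟩ = z := by
      rw [hFf, ← hT ⟨J, y, hy, hsum⟩ z]
      congr 1
      funext j
      exact (hJ j j.2).symm
    simp only [R, Set.mem_ofPred_eq, hzJ]
    exact ⟨(hmem x z).1 hz, fun j => (hJ j j.2).ge⟩
  have hsub : ∀ J x, x ∈ R J → (x, F J x + f J) ∈ P := fun J x hx => (hmem _ _).2 hx.1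
  have hcons : ∀ J J' x, x ∈ R J → x ∈ R J' → F J x + f J = F J' x + f J' := by
    intro J J' x hx hx'
    rcases le_total (c' (F J x + f J)) (c' (F J' x + f J')) with h | h
    · exact huniq J' x hx' _ (hsub J x hx) h
    · exact (huniq J x hx _ (hsub J' x hx') h).symm
  have hsel : ∀ x, ∃ z, ∀ J, x ∈ R J → z = F J x + f J := fun x => by
    by_cases hx : ∃ J, x ∈ R J
    · obtain ⟨J, hJ⟩ := hx
      exact ⟨F J x + f J, fun J' hJ' => hcons J J' x hJ hJ'⟩
    · exact ⟨0, fun J hJ => absurd ⟨J, hJ⟩ hx⟩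
  choose g hg using hsel
  refine ⟨g, fun x hx => ?_, κ, inferInstance, R, F, f, hR, ?_, fun J x hx => hg x J hx⟩
  · obtain ⟨J, hJ⟩ := hcover x hx
    rw [hg x J hJ]
    exact ⟨hsub J x hJ, hmin J x hJ⟩
  · exact Set.Subset.antisymm (Set.iUnion_subset fun J x hx => ⟨_, hsub J x hx, rfl⟩)
      fun x hx => Set.mem_iUnion.2 (hcover x hx)

/-! ### Continuity and polyhedral partitions from affine covers. -/

theorem IsPolyhedral.exists_eq_polyhedron {n : ℕ} {S : Set (Fin n → ℝ)} (hS : IsPolyhedral S) :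
    ∃ (m : ℕ) (H : Matrix (Fin m) (Fin n) ℝ) (h : Fin m → ℝ), polyhedron H h = S := by
  obtain ⟨ι, _, a, b, rfl⟩ := hS
  let e := Fintype.equivFin ι
  refine ⟨Fintype.card ι, LinearMap.toMatrix' (LinearMap.pi fun i => a (e.symm i)),
    fun i => b (e.symm i), ?_⟩
  ext x
  simp only [polyhedron, Set.mem_ofPred_eq, LinearMap.toMatrix'_mulVec, Pi.le_def,
    LinearMap.pi_apply]
  exact e.symm.forall_congr_right (q := fun i => a i x ≤ b i)

theorem interior_hyperplane_eq_empty {W : Type*} [AddCommGroup W] [Module ℝ W]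
    [TopologicalSpace W] [ContinuousAdd W] [ContinuousSMul ℝ W] {a : W →ₗ[ℝ] ℝ} (ha : a ≠ 0)
    (b : ℝ) : interior {x | a x = b} = ∅ := by
  rw [Set.eq_empty_iff_forall_notMem]
  intro x hx
  obtain ⟨v, hv⟩ : ∃ v, a v ≠ 0 := by
    by_contra h
    push Not at h
    exact ha (LinearMap.ext h)
  have hcont : Continuous fun t : ℝ => x + t • v := by fun_prop
  have hev : ∀ᶠ t : ℝ in nhds 0, x + t • v ∈ interior {x | a x = b} :=
    hcont.tendsto 0 |>.eventually (isOpen_interior.mem_nhds (by simpa using hx))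
  obtain ⟨t, ht, ht0⟩ :=
    ((hev.filter_mono nhdsWithin_le_nhds).and (self_mem_nhdsWithin (s := Set.Ioi 0))).exists
  have h1 : x + t • v ∈ {x | a x = b} := interior_subset ht
  have h2 : x ∈ {x | a x = b} := interior_subset hx
  rw [Set.mem_ofPred_eq] at h1 h2
  rw [map_add, map_smul, smul_eq_mul, h2, add_eq_left] at h1
  exact (mul_ne_zero ht0.ne' hv) h1

namespace HasAffineCover

theorem continuousOn {X E : Type*} [NormedAddCommGroup X] [NormedSpace ℝ X]
    [FiniteDimensional ℝ X] [NormedAddCommGroup E] [NormedSpace ℝ E] {g : X → E} {D : Set X}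
    (h : HasAffineCover g D) : ContinuousOn g D := by
  obtain ⟨κ, _, R, F, f, hR, rfl, hg⟩ := h
  refine (locallyFinite_of_finite R).continuousOn_iUnion (fun k => (hR k).isClosed) fun k => ?_
  exact ((F k).continuous_of_finiteDimensional.add continuous_const).continuousOn.congr (hg k)

theorem comp_linear {X E E' : Type*} [AddCommGroup X] [Module ℝ X] [AddCommGroup E] [Module ℝ E]
    [AddCommGroup E'] [Module ℝ E'] {g : X → E} {D : Set X} (h : HasAffineCover g D)
    (L : E →ₗ[ℝ] E') : HasAffineCover (fun x => L (g x)) D := by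
  obtain ⟨κ, _, R, F, f, hR, hD, hg⟩ := h
  exact ⟨κ, inferInstance, R, fun k => L ∘ₗ F k, fun k => L (f k), hR, hD, fun k x hx => by
    simp [hg k x hx]⟩

/-- The pieces of an affine cover can be refined, by the hyperplanes that bound them, to a
polyhedral partition. -/
theorem isPiecewiseAffineOn {n : ℕ} {g : (Fin n → ℝ) → (Fin n → ℝ)} {D : Set (Fin n → ℝ)}
    (hg : HasAffineCover g D) : IsPiecewiseAffineOn g D := by
  classical
  obtain ⟨κ, _, R, F, f, hR, rfl, hgR⟩ := hg
  choose ι hι a b hab using hR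
  let sgn : Bool → ℝ := fun s => if s then 1 else -1
  let cell : ((Σ k, ι k) → Bool) → Set (Fin n → ℝ) :=
    fun s => {x | ∀ r, (sgn (s r) • a r.1 r.2) x ≤ sgn (s r) * b r.1 r.2}
  -- A zero functional bounds no hyperplane, so both signs could give overlapping cells; its sign is
  -- fixed by that of `b`. The other signs separate distinct cells.
  let Idx := {s : (Σ k, ι k) → Bool //
    (∀ r, a r.1 r.2 = 0 → (s r = true ↔ 0 ≤ b r.1 r.2)) ∧ ∃ k, cell s ⊆ R k}
  have hcell : ∀ s : Idx, ∃ (m : ℕ) (H : Matrix (Fin m) (Fin n) ℝ) (h : Fin m → ℝ),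
      polyhedron H h = cell s.1 := fun s =>
    IsPolyhedral.exists_eq_polyhedron ⟨_, inferInstance, _, _, rfl⟩
  choose m H h hH using hcell
  choose piece hpiece using fun s : Idx => s.2.2
  let e := (Fintype.equivFin Idx).symm
  refine ⟨Fintype.card Idx, fun i => m (e i), fun i => H (e i), fun i => h (e i),
    fun i => LinearMap.toMatrix' (F (piece (e i))), fun i => f (piece (e i)), ?_, ?_, ?_⟩
  · simp only [hH]
    refine Set.Subset.antisymm (Set.iUnion_subset fun i =>
      (hpiece (e i)).trans (Set.subset_iUnion R _)) (Set.iUnion_subset fun k x hx => ?_)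
    -- The sign vector of `x` is `true` on every inequality of `R k`, so its whole cell lies in `R
    -- k`.
    let s : (Σ k, ι k) → Bool := fun r => decide (a r.1 r.2 x ≤ b r.1 r.2)
    have hxs : x ∈ cell s := fun r => by
      by_cases hr : a r.1 r.2 x ≤ b r.1 r.2
      · simp [s, hr, sgn]
      · simpa [s, hr, sgn] using (not_le.1 hr).le
    have hsub : cell s ⊆ R k := by
      intro z hz
      rw [hab] at hx ⊢
      intro i
      have := hz ⟨k, i⟩
      simpa [s, sgn, hx i] using this
    let S : Idx := ⟨s, fun r hr => by simp [s, hr], k, hsub⟩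
    refine Set.mem_iUnion.2 ⟨e.symm S, ?_⟩
    rw [e.apply_symm_apply]
    exact hxs
  · intro i j hij
    simp only [hH]
    obtain ⟨r, hr⟩ : ∃ r, (e i).1 r ≠ (e j).1 r := by
      by_contra hcon
      push Not at hcon
      exact hij (e.injective (Subtype.ext (funext hcon)))
    have har : a r.1 r.2 ≠ 0 := fun h0 => hr (by
      rw [Bool.eq_iff_iff, (e i).2.1 r h0, (e j).2.1 r h0])
    rw [Set.disjoint_iff_inter_eq_empty, ← interior_inter, Set.eq_empty_iff_forall_notMem]
    intro x hx
    have hsub : cell (e i).1 ∩ cell (e j).1 ⊆ {x | a r.1 r.2 x = b r.1 r.2} := by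
      rintro z ⟨hz, hz'⟩
      have h1 := hz r
      have h2 := hz' r
      rcases hi : (e i).1 r <;> rcases hj : (e j).1 r <;>
        simp only [hi, hj, ne_eq, not_true_eq_false] at hr
      all_goals
        simp only [hi, hj, sgn, LinearMap.smul_apply, smul_eq_mul, if_true, one_mul,
          Bool.false_eq_true, if_false] at h1 h2
        exact le_antisymm (by linarith) (by linarith)
    have := interior_mono hsub hx
    rw [interior_hyperplane_eq_empty har] at this
    exact this
  · intro i x hx
    rw [hH] at hx
    rw [LinearMap.toMatrix'_mulVec]
    exact hgR _ x (hpiece _ hx)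

end HasAffineCover

/-! ### The control problem as a parametric linear program. -/

theorem IsPolyhedral.setOf_le_add {W : Type*} [AddCommGroup W] [Module ℝ W] (f g : W →ₗ[ℝ] ℝ)
    (b : ℝ) : IsPolyhedral {x | f x ≤ g x + b} := by
  convert IsPolyhedral.halfSpace (f - g) b using 1
  ext x
  simp only [Set.mem_ofPred_eq, LinearMap.sub_apply, sub_le_iff_le_add']

theorem EReal.coe_le_coe_mul_sub_coe_iff {w : ℝ} {γ : EReal} (hw : 0 < w) (hγ : 0 < γ)
    (y x : ℝ) : (y : EReal) ≤ (w : EReal) * (γ - (x : EReal)) ↔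
      γ = ⊤ ∨ y ≤ w * (γ.toReal - x) := by
  induction γ with
  | bot => exact absurd hγ (by simp)
  | top => simp [EReal.coe_mul_top_of_pos hw]
  | coe γ =>
    simp only [EReal.coe_ne_top, false_or, EReal.toReal_coe]
    norm_cast

namespace TrafficNetwork

variable {n : ℕ} {V : Type*} (net : TrafficNetwork n V)

theorem constraints_iff (k : ℕ) (lam x u : Fin n → ℝ) :
    net.Constraints k lam x u ↔ ∀ i, 0 ≤ u i ∧ u i ≤ net.freeSpeed i / net.len i * x i ∧
      u i ≤ net.capacity i ∧ 0 ≤ net.inflow k lam u i ∧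
      net.inflow k lam u i ≤ net.capacity i ∧
      (net.jamDensity i = ⊤ ∨ net.inflow k lam u i ≤
        net.waveSpeed i * ((net.jamDensity i).toReal - 1 / net.len i * x i)) := by
  refine forall_congr' fun i => ?_
  rw [le_min_iff, le_min_iff, EReal.coe_le_coe_mul_sub_coe_iff (net.waveSpeed_pos i)
    (net.jamDensity_pos i), EReal.coe_le_coe_iff]
  tauto

/-- The inflow rates without exogenous inflow, as a linear function of the outflow rates. -/
def inflowMap (k : ℕ) : (Fin n → ℝ) →ₗ[ℝ] (Fin n → ℝ) where
  toFun u := net.inflow k 0 u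
  map_add' u v := by
    ext i
    simp [inflow, mul_add, Finset.sum_add_distrib]
  map_smul' t u := by
    ext i
    simp [inflow, Finset.mul_sum, mul_left_comm]

/-- One step of the dynamics without exogenous inflow, as a linear map. -/
def stepMap (k : ℕ) : (Fin n → ℝ) × (Fin n → ℝ) →ₗ[ℝ] (Fin n → ℝ) :=
  LinearMap.fst ℝ _ _ + net.Ts • ((net.inflowMap k - LinearMap.id) ∘ₗ LinearMap.snd ℝ _ _)

theorem stepMap_apply (k : ℕ) (x u : Fin n → ℝ) : net.stepMap k (x, u) = net.step k 0 x u := by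
  ext i
  simp [stepMap, step, inflowMap]

theorem isPolyhedral_constraints (k : ℕ) :
    IsPolyhedral {p : (Fin n → ℝ) × (Fin n → ℝ) | net.Constraints k 0 p.1 p.2} := by
  let X : Fin n → (Fin n → ℝ) × (Fin n → ℝ) →ₗ[ℝ] ℝ := fun i =>
    LinearMap.proj i ∘ₗ LinearMap.fst ℝ _ _
  let U : Fin n → (Fin n → ℝ) × (Fin n → ℝ) →ₗ[ℝ] ℝ := fun i =>
    LinearMap.proj i ∘ₗ LinearMap.snd ℝ _ _
  let Y : Fin n → (Fin n → ℝ) × (Fin n → ℝ) →ₗ[ℝ] ℝ := fun i =>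
    LinearMap.proj i ∘ₗ net.inflowMap k ∘ₗ LinearMap.snd ℝ _ _
  have hsupply : ∀ i, IsPolyhedral {p | net.jamDensity i = ⊤ ∨
      Y i p ≤ net.waveSpeed i * ((net.jamDensity i).toReal - 1 / net.len i * X i p)} := fun i => by
    by_cases hi : net.jamDensity i = ⊤
    -- With infinite jam density there is no supply bound; the whole space is written as `0 ≤ 0`.
    · convert IsPolyhedral.setOf_le_add (0 : (Fin n → ℝ) × (Fin n → ℝ) →ₗ[ℝ] ℝ) 0 0 using 1
      ext p
      simp [hi]
    · convert IsPolyhedral.setOf_le_add (Y i) (-(net.waveSpeed i * (1 / net.len i)) • X i)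
        (net.waveSpeed i * (net.jamDensity i).toReal) using 1
      ext p
      simp only [Set.mem_ofPred_eq, hi, false_or, LinearMap.smul_apply, smul_eq_mul]
      ring_nf
  have hall : IsPolyhedral (⋂ i, ({p | (0 : _ →ₗ[ℝ] ℝ) p ≤ U i p + 0} ∩
      ({p | U i p ≤ ((net.freeSpeed i / net.len i) • X i) p + 0} ∩
      ({p | U i p ≤ (0 : _ →ₗ[ℝ] ℝ) p + net.capacity i} ∩
      ({p | (0 : _ →ₗ[ℝ] ℝ) p ≤ Y i p + 0} ∩
      ({p | Y i p ≤ (0 : _ →ₗ[ℝ] ℝ) p + net.capacity i} ∩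
      {p | net.jamDensity i = ⊤ ∨ Y i p ≤ net.waveSpeed i *
        ((net.jamDensity i).toReal - 1 / net.len i * X i p)})))))) :=
    IsPolyhedral.iInter fun i => (IsPolyhedral.setOf_le_add _ _ _).inter
      ((IsPolyhedral.setOf_le_add _ _ _).inter ((IsPolyhedral.setOf_le_add _ _ _).inter
      ((IsPolyhedral.setOf_le_add _ _ _).inter ((IsPolyhedral.setOf_le_add _ _ _).inter
      (hsupply i)))))
  convert hall using 1
  ext p
  simp only [Set.mem_ofPred_eq, constraints_iff, Set.mem_iInter, Set.mem_inter_iff,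
    LinearMap.zero_apply, add_zero, zero_add, LinearMap.smul_apply, smul_eq_mul]
  rfl

/-- The `m`-th outflow vector of a sequence of `M` outflow vectors. -/
def control (n M m : ℕ) : (Fin M → Fin n → ℝ) →ₗ[ℝ] (Fin n → ℝ) :=
  if h : m < M then LinearMap.proj ⟨m, h⟩ else 0

theorem control_apply {M m : ℕ} (h : m < M) (z : Fin M → Fin n → ℝ) :
    control n M m z = z ⟨m, h⟩ := by
  simp [control, h]

/-- The state at time `k + m`, without exogenous inflow, as a linear function of the state at time
`k` and the sequence of outflows. -/
def stateMap (k M : ℕ) : ℕ → (Fin n → ℝ) × (Fin M → Fin n → ℝ) →ₗ[ℝ] (Fin n → ℝ)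
  | 0 => LinearMap.fst ℝ _ _
  | m + 1 => net.stepMap (k + m) ∘ₗ
      (stateMap k M m).prod (control n M m ∘ₗ LinearMap.snd ℝ _ _)

/-- The initial states at time `k` and sequences of `M` outflows that satisfy the constraints. -/
def feasiblePairs (k M : ℕ) : Set ((Fin n → ℝ) × (Fin M → Fin n → ℝ)) :=
  {p | ∀ m < M, net.Constraints (k + m) 0 (net.stateMap k M m p) (control n M m p.2)}

theorem isPolyhedral_feasiblePairs (k M : ℕ) : IsPolyhedral (net.feasiblePairs k M) := by
  have h : IsPolyhedral (⋂ m : Fin M, (net.stateMap k M m).prod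
      (control n M m ∘ₗ LinearMap.snd ℝ _ _) ⁻¹' {p | net.Constraints (k + m) 0 p.1 p.2}) :=
    IsPolyhedral.iInter fun m => (net.isPolyhedral_constraints (k + m)).preimage _
  convert h using 1
  ext p
  simp only [feasiblePairs, Set.mem_ofPred_eq, Set.mem_iInter, Fin.forall_iff]
  rfl

/-- Capacities confine the outflows to a box, which makes minimizers exist even when jam densities
are infinite. -/
theorem isBounded_feasiblePairs_section (k M : ℕ) (x : Fin n → ℝ) :
    Bornology.IsBounded {z | (x, z) ∈ net.feasiblePairs k M} := by
  refine (Metric.isBounded_Icc (0 : Fin M → Fin n → ℝ) fun _ => net.capacity).subset ?_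
  intro z hz
  have h : ∀ (m : Fin M) (i : Fin n), 0 ≤ z m i ∧ z m i ≤ net.capacity i := fun m i => by
    have := (net.constraints_iff _ _ _ _).1 (hz m m.2) i
    rw [control_apply m.2] at this
    exact ⟨this.1, this.2.2.1⟩
  exact ⟨fun m i => (h m i).1, fun m i => (h m i).2⟩

theorem isFeasible_of_mem_feasiblePairs {k M : ℕ} {p : (Fin n → ℝ) × (Fin M → Fin n → ℝ)}
    (hp : p ∈ net.feasiblePairs k M) :
    net.IsFeasible 0 k (k + M) p.1 (fun j => net.stateMap k M (j - k) p)
      (fun j => control n M (j - k) p.2) := by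
  refine ⟨by simp [stateMap], fun j hkj hj => ?_⟩
  obtain ⟨m, rfl⟩ := Nat.exists_eq_add_of_le hkj
  have hm : m < M := by omega
  simp only [show k + m + 1 - k = m + 1 by omega, Nat.add_sub_cancel_left]
  exact ⟨net.stepMap_apply _ _ _, hp m hm⟩

theorem stateMap_eq_of_isFeasible {k M : ℕ} {x0 : Fin n → ℝ} {x u : ℕ → Fin n → ℝ}
    (h : net.IsFeasible 0 k (k + M) x0 x u) {m : ℕ} (hm : m ≤ M) :
    net.stateMap k M m (x0, fun m => u (k + m)) = x (k + m) := by
  induction m with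
  | zero => exact h.1.symm
  | succ m ih =>
    have h1 := (h.2 (k + m) (by omega) (by omega)).1
    rw [← add_assoc, h1]
    change net.stepMap (k + m) (net.stateMap k M m (x0, fun m => u (k + m)),
      control n M m fun m => u (k + m)) = _
    rw [ih (by omega), control_apply (by omega : m < M), stepMap_apply]
    rfl

theorem mem_feasiblePairs_of_isFeasible {k M : ℕ} {x0 : Fin n → ℝ} {x u : ℕ → Fin n → ℝ}
    (h : net.IsFeasible 0 k (k + M) x0 x u) :
    (x0, fun m : Fin M => u (k + m)) ∈ net.feasiblePairs k M := by
  intro m hm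
  rw [net.stateMap_eq_of_isFeasible h hm.le, control_apply hm]
  exact (h.2 (k + m) (by omega) (by omega)).2

theorem fst_image_feasiblePairs (k M : ℕ) :
    Prod.fst '' net.feasiblePairs k M = net.feasibleStates 0 k (k + M) := by
  ext x0
  constructor
  · rintro ⟨p, hp, rfl⟩
    exact ⟨_, _, net.isFeasible_of_mem_feasiblePairs hp⟩
  · rintro ⟨x, u, h⟩
    exact ⟨_, net.mem_feasiblePairs_of_isFeasible h, rfl⟩

/-- The cost on `[k, k + M]` as a linear function of the state at time `k` and the outflows. -/
def costMap (α β : ℕ → Fin n → ℝ) (k M : ℕ) :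
    (Fin n → ℝ) × (Fin M → Fin n → ℝ) →ₗ[ℝ] ℝ :=
  ∑ i, α (k + M) i • (LinearMap.proj i ∘ₗ net.stateMap k M M) +
    ∑ m ∈ Finset.range M, ∑ i, (α (k + m) i • (LinearMap.proj i ∘ₗ net.stateMap k M m) +
      β (k + m) i • (LinearMap.proj i ∘ₗ control n M m ∘ₗ LinearMap.snd ℝ _ _))

theorem cost_eq_costMap (α β : ℕ → Fin n → ℝ) {k M : ℕ}
    {p : (Fin n → ℝ) × (Fin M → Fin n → ℝ)} {x u : ℕ → Fin n → ℝ}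
    (hx : ∀ m ≤ M, net.stateMap k M m p = x (k + m))
    (hu : ∀ m < M, control n M m p.2 = u (k + m)) :
    cost α β k (k + M) x u = net.costMap α β k M p := by
  simp only [cost, costMap, LinearMap.add_apply, LinearMap.sum_apply, LinearMap.smul_apply,
    LinearMap.comp_apply, LinearMap.proj_apply, smul_eq_mul, LinearMap.snd_apply,
    Finset.sum_Ico_eq_sum_range, Nat.add_sub_cancel_left]
  rw [hx M le_rfl]
  congr 1
  refine Finset.sum_congr rfl fun m hm => ?_
  rw [Finset.mem_range] at hm
  rw [hx m hm.le, hu m hm]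

/-- The first move of an optimal solution can be selected piecewise affinely in the state. -/
theorem exists_optimal_first_move (α β : ℕ → Fin n → ℝ) {k N : ℕ} (hk : k < N) :
    ∃ φ : (Fin n → ℝ) → (Fin n → ℝ),
      (∀ x0 ∈ net.feasibleStates 0 k N, ∃ x u, net.IsOptimal α β 0 k N x0 x u ∧ u k = φ x0) ∧
        HasAffineCover φ (net.feasibleStates 0 k N) := by
  obtain ⟨M, rfl⟩ := Nat.exists_eq_add_of_lt hk
  rw [add_assoc]
  obtain ⟨g, hg, hcover⟩ := exists_minimizer_hasAffineCover
    (net.isPolyhedral_feasiblePairs k (M + 1)) (net.isBounded_feasiblePairs_section k (M + 1))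
    (net.costMap α β k (M + 1) ∘ₗ LinearMap.inr ℝ _ _)
  rw [fst_image_feasiblePairs] at hg hcover
  -- For fixed `x` the cost is a constant plus a functional of `z` independent of `x`, so the
  -- parameter enters only through the constraints.
  have hsplit : ∀ x z, net.costMap α β k (M + 1) (x, z) = net.costMap α β k (M + 1) (x, 0) +
      (net.costMap α β k (M + 1) ∘ₗ LinearMap.inr ℝ _ _) z := fun x z => by
    rw [LinearMap.comp_apply, LinearMap.inr_apply, ← map_add]
    simp
  refine ⟨fun x => control n (M + 1) 0 (g x), fun x0 hx0 =>
    ⟨fun j => net.stateMap k (M + 1) (j - k) (x0, g x0),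
      fun j => control n (M + 1) (j - k) (g x0), ⟨?_, fun x' u' h' => ?_⟩, by simp⟩,
    hcover.comp_linear _⟩
  · exact net.isFeasible_of_mem_feasiblePairs (hg x0 hx0).1
  · rw [net.cost_eq_costMap α β (p := (x0, g x0)) (by simp) (by simp),
      net.cost_eq_costMap α β (fun m hm => net.stateMap_eq_of_isFeasible h' hm)
        (fun m hm => control_apply hm _), hsplit x0 (g x0),
      hsplit x0 fun m => u' (k + m)]
    exact add_le_add_right ((hg x0 hx0).2 _ (net.mem_feasiblePairs_of_isFeasible h')) _

/-! ### Closed loops and dynamic programming. -/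

theorem closedLoop_start (lam : ℕ → Fin n → ℝ) (φ : ℕ → (Fin n → ℝ) → (Fin n → ℝ)) (k : ℕ)
    (x0 : Fin n → ℝ) : net.closedLoop lam φ k x0 k = x0 := by
  cases k <;> simp [closedLoop]

theorem closedLoop_succ (lam : ℕ → Fin n → ℝ) (φ : ℕ → (Fin n → ℝ) → (Fin n → ℝ)) {k j : ℕ}
    (h : k ≤ j) (x0 : Fin n → ℝ) : net.closedLoop lam φ k x0 (j + 1) =
      net.step j (lam j) (net.closedLoop lam φ k x0 j) (φ j (net.closedLoop lam φ k x0 j)) := by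
  simp [closedLoop, h]

theorem closedLoop_eq_closedLoop_step (lam : ℕ → Fin n → ℝ)
    (φ : ℕ → (Fin n → ℝ) → (Fin n → ℝ)) (k : ℕ) (x0 : Fin n → ℝ) {j : ℕ} (h : k + 1 ≤ j) :
    net.closedLoop lam φ k x0 j =
      net.closedLoop lam φ (k + 1) (net.step k (lam k) x0 (φ k x0)) j := by
  induction j, h using Nat.le_induction with
  | base => rw [closedLoop_start, closedLoop_succ _ _ _ le_rfl, closedLoop_start]
  | succ j h ih => rw [closedLoop_succ _ _ _ h, closedLoop_succ _ _ _ (by omega), ih]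

theorem cost_eq_add_cost (α β : ℕ → Fin n → ℝ) {k N : ℕ} (hk : k < N) (x u : ℕ → Fin n → ℝ) :
    cost α β k N x u =
      ∑ i, (α k i * x k i + β k i * u k i) + cost α β (k + 1) N x u := by
  rw [cost, cost, Finset.sum_eq_sum_Ico_succ_bot hk]
  ring

theorem cost_congr (α β : ℕ → Fin n → ℝ) {k N : ℕ} (hk : k ≤ N) {x x' u u' : ℕ → Fin n → ℝ}
    (hx : ∀ j, k ≤ j → x j = x' j) (hu : ∀ j, k ≤ j → u j = u' j) :
    cost α β k N x u = cost α β k N x' u' := by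
  rw [cost, cost, hx N hk]
  congr 1
  refine Finset.sum_congr rfl fun j hj => ?_
  rw [hx j (Finset.mem_Ico.1 hj).1, hu j (Finset.mem_Ico.1 hj).1]

theorem IsFeasible.tail {net : TrafficNetwork n V} {lam : ℕ → Fin n → ℝ} {k N : ℕ}
    {x0 : Fin n → ℝ} {x u : ℕ → Fin n → ℝ} (h : net.IsFeasible lam k N x0 x u) (hk : k < N) :
    net.IsFeasible lam (k + 1) N (net.step k (lam k) x0 (u k)) x u := by
  refine ⟨?_, fun j hj => h.2 j (by omega)⟩
  rw [(h.2 k le_rfl hk).1, h.1]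

/-- The principle of optimality: a feedback that always makes the first move of some optimal
solution is optimal. -/
theorem isOptimal_closedLoop (α β : ℕ → Fin n → ℝ) {N : ℕ}
    {φ : ℕ → (Fin n → ℝ) → (Fin n → ℝ)} (lam : ℕ → Fin n → ℝ)
    (hφ : ∀ k < N, ∀ x0 ∈ net.feasibleStates lam k N,
      ∃ x u, net.IsOptimal α β lam k N x0 x u ∧ u k = φ k x0)
    {k : ℕ} (hk : k ≤ N) (x0 : Fin n → ℝ) (hx0 : x0 ∈ net.feasibleStates lam k N) :
    net.IsOptimal α β lam k N x0 (net.closedLoop lam φ k x0)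
      (fun j => φ j (net.closedLoop lam φ k x0 j)) := by
  induction hk using Nat.decreasingInduction generalizing x0 with
  | self =>
    refine ⟨⟨net.closedLoop_start _ _ _ _, fun j h1 h2 => absurd h1 (by omega)⟩,
      fun x' u' h' => ?_⟩
    simp [cost, closedLoop_start, h'.1]
  | of_succ k hk ih =>
    obtain ⟨x, u, ⟨hfeas, hopt⟩, huk⟩ := hφ k hk x0 hx0
    have htail := hfeas.tail hk
    rw [huk] at htail
    obtain ⟨ihf, iho⟩ := ih _ ⟨x, u, htail⟩
    have hcl : ∀ j, k + 1 ≤ j → net.closedLoop lam φ k x0 j =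
        net.closedLoop lam φ (k + 1) (net.step k (lam k) x0 (φ k x0)) j :=
      fun j hj => net.closedLoop_eq_closedLoop_step lam φ k x0 hj
    refine ⟨⟨net.closedLoop_start _ _ _ _, fun j hj hjN =>
      ⟨net.closedLoop_succ _ _ hj _, ?_⟩⟩, fun x' u' h' => le_trans ?_ (hopt x' u' h')⟩
    · beta_reduce
      rcases hj.eq_or_lt with rfl | hj
      · rw [closedLoop_start, ← huk, ← hfeas.1]
        exact (hfeas.2 k le_rfl hjN).2
      · rw [hcl j hj]
        exact (ihf.2 j hj hjN).2
    -- The stage costs at `k` agree, and the tail of the optimal solution is a competitor for the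
    -- closed loop restarted from the common successor.
    · rw [cost_eq_add_cost α β hk, cost_eq_add_cost α β hk, closedLoop_start, huk, hfeas.1]
      refine add_le_add_right ?_ _
      rw [cost_congr α β hk hcl (fun j hj => by rw [hcl j hj])]
      exact iho _ _ htail

/-! ### Admissible states and exogenous inflows. -/

theorem inflow_zero_outflow (k : ℕ) (i : Fin n) : net.inflow k 0 0 i = 0 := by
  simp [inflow]

theorem density_le_jamDensity_iff (x : Fin n → ℝ) (i : Fin n) :
    ((x i / net.len i : ℝ) : EReal) ≤ net.jamDensity i ↔
      net.jamDensity i = ⊤ ∨ 1 / net.len i * x i ≤ (net.jamDensity i).toReal := by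
  have hγ := net.jamDensity_pos i
  rw [one_div_mul_eq_div]
  generalize net.jamDensity i = γ at hγ
  induction γ with
  | bot => exact absurd hγ (by simp)
  | top => simp
  | coe γ => simp

/-- Holding all traffic, with zero outflow, leaves the state fixed and satisfies every constraint.
-/
theorem AdmissibleState.mem_feasibleStates {net : TrafficNetwork n V} {x0 : Fin n → ℝ}
    (h : net.AdmissibleState x0) (k N : ℕ) : x0 ∈ net.feasibleStates 0 k N := by
  refine ⟨fun _ => x0, fun _ => 0, rfl, fun j _ _ => ⟨?_, ?_⟩⟩
  · ext i
    simp [step, inflow]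
  · rw [constraints_iff]
    intro i
    have hi := net.inflow_zero_outflow j i
    simp only [Pi.zero_apply] at hi ⊢
    rw [hi]
    refine ⟨le_rfl, mul_nonneg (div_pos (net.freeSpeed_pos i) (net.len_pos i)).le (h i).1,
      net.capacity_nonneg i, le_rfl, net.capacity_nonneg i, ?_⟩
    refine ((net.density_le_jamDensity_iff x0 i).1 (h i).2).imp_right fun hx => ?_
    exact mul_nonneg (net.waveSpeed_pos i).le (sub_nonneg.2 hx)

/-- The Courant-Friedrichs-Lewy conditions keep the traffic masses admissible. -/
theorem AdmissibleState.step {net : TrafficNetwork n V} {k : ℕ} {lam x u : Fin n → ℝ}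
    (hx : net.AdmissibleState x) (h : net.Constraints k lam x u) :
    net.AdmissibleState (net.step k lam x u) := by
  rw [constraints_iff] at h
  intro i
  obtain ⟨_, hu, _, hy, _, hs⟩ := h i
  have hlen := net.len_pos i
  have hTs := net.Ts_pos
  refine ⟨?_, ?_⟩
  · have h1 : net.Ts * u i ≤ x i := calc
      net.Ts * u i ≤ net.Ts * (net.freeSpeed i / net.len i * x i) := by gcongr
      _ = net.freeSpeed i * net.Ts / net.len i * x i := by ring
      _ ≤ 1 * x i := mul_le_mul_of_nonneg_right
        ((div_le_one hlen).2 (net.cfl_forward i)) (hx i).1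
      _ = x i := one_mul _
    have h2 := mul_nonneg hTs.le hy
    simp only [TrafficNetwork.step]
    linarith
  · rw [density_le_jamDensity_iff]
    by_cases htop : net.jamDensity i = ⊤
    · exact Or.inl htop
    have hx' := ((net.density_le_jamDensity_iff x i).1 (hx i).2).resolve_left htop
    refine Or.inr ?_
    have hs' := hs.resolve_left htop
    set s := (net.jamDensity i).toReal - 1 / net.len i * x i with hsdef
    -- The inflow of one period uses at most the residual density `s`, because `waveSpeed * Ts ≤
    -- len`.
    have h1 : 1 / net.len i * (net.Ts * net.inflow k lam u i) ≤ s := calc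
      1 / net.len i * (net.Ts * net.inflow k lam u i)
          ≤ 1 / net.len i * (net.Ts * (net.waveSpeed i * s)) := by gcongr
      _ = net.waveSpeed i * net.Ts / net.len i * s := by ring
      _ ≤ 1 * s := mul_le_mul_of_nonneg_right
        ((div_le_one hlen).2 (net.cfl_backward i)) (sub_nonneg.2 hx')
      _ = s := one_mul _
    have h2 : 0 ≤ 1 / net.len i * (net.Ts * u i) := by
      have := (h i).1
      positivity
    have h3 : 1 / net.len i * net.step k lam x u i = 1 / net.len i * x i +
        1 / net.len i * (net.Ts * net.inflow k lam u i) - 1 / net.len i * (net.Ts * u i) := by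
      simp only [TrafficNetwork.step]
      ring
    linarith

theorem sum_splitRatio_onRamp (k : ℕ) {i : Fin n} (hi : i ∈ net.onRamps) (u : Fin n → ℝ) :
    ∑ j, net.splitRatio k j i * u j = 0 :=
  Finset.sum_eq_zero fun j _ => by
    rw [net.splitRatio_not_adj k j i (net.no_inNbr_onRamp i hi j), zero_mul]

/-- Admissible exogenous inflows do not affect the validity of the constraints. -/
theorem Constraints.of_zero_inflow {net : TrafficNetwork n V} {k : ℕ} {lam x u : Fin n → ℝ}
    (h : net.Constraints k 0 x u)
    (hlam : ∀ i, 0 ≤ lam i ∧ lam i ≤ net.capacity i ∧ (i ∉ net.onRamps → lam i = 0)) :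
    net.Constraints k lam x u := by
  rw [constraints_iff] at h ⊢
  intro i
  obtain ⟨h1, h2, h3, h4, h5, h6⟩ := h i
  by_cases hi : i ∈ net.onRamps
  · have hy : net.inflow k lam u i = lam i := by
      rw [inflow, net.sum_splitRatio_onRamp k hi, add_zero]
    rw [hy]
    exact ⟨h1, h2, h3, (hlam i).1, (hlam i).2.1, Or.inl (net.jamDensity_onRamp i hi)⟩
  · have hy : net.inflow k lam u i = net.inflow k 0 u i := by
      rw [inflow, inflow, (hlam i).2.2 hi, Pi.zero_apply]
    rw [hy]
    exact h i

/-- The law is optimal from every feasible state at time `k`, so `x` need not lie on a zero-inflow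
trajectory; only feasibility of the first move is used. -/
theorem IsZeroInflowOptimalLaw.constraints {net : TrafficNetwork n V} {α β : ℕ → Fin n → ℝ}
    {N : ℕ} {φ : ℕ → (Fin n → ℝ) → (Fin n → ℝ)} (hφ : net.IsZeroInflowOptimalLaw α β N φ)
    {k : ℕ} (hk : k < N) {x : Fin n → ℝ} (hx : net.AdmissibleState x) :
    net.Constraints k 0 x (φ k x) := by
  have h := ((hφ k hk x (hx.mem_feasibleStates k N)).1.2 k le_rfl hk).2
  simpa only [closedLoop_start, Pi.zero_apply] using h

end TrafficNetwork

theorem mainTheorem2 {n : ℕ} {V : Type*} (net : TrafficNetwork n V) (N : ℕ)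
    (α β : ℕ → Fin n → ℝ) (hα : ∀ k ≤ N, ∀ i, 0 ≤ α k i) :
    (∃ φ : ℕ → (Fin n → ℝ) → (Fin n → ℝ), net.IsZeroInflowOptimalLaw α β N φ ∧
      ∀ k < N, ContinuousOn (φ k) (net.feasibleStates 0 k N) ∧
        IsPiecewiseAffineOn (φ k) (net.feasibleStates 0 k N)) ∧
    (∀ φ : ℕ → (Fin n → ℝ) → (Fin n → ℝ), net.IsZeroInflowOptimalLaw α β N φ →
      ∀ lam : ℕ → Fin n → ℝ, net.AdmissibleInflow N lam →
      ∀ x0 : Fin n → ℝ, net.AdmissibleState x0 →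
        net.IsFeasible lam 0 N x0 (net.closedLoop lam φ 0 x0)
          (fun k => φ k (net.closedLoop lam φ 0 x0 k))) := by
  constructor
  · have hex : ∀ k, ∃ φ : (Fin n → ℝ) → (Fin n → ℝ), k < N →
        (∀ x0 ∈ net.feasibleStates 0 k N,
          ∃ x u, net.IsOptimal α β 0 k N x0 x u ∧ u k = φ x0) ∧
        HasAffineCover φ (net.feasibleStates 0 k N) := fun k => by
      by_cases hk : k < N
      · obtain ⟨φ, h⟩ := net.exists_optimal_first_move α β hk
        exact ⟨φ, fun _ => h⟩
      · exact ⟨0, fun h => absurd h hk⟩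
    choose φ hφ using hex
    exact ⟨φ, fun k hk x0 hx0 =>
      net.isOptimal_closedLoop α β 0 (fun k hk => (hφ k hk).1) hk.le x0 hx0,
      fun k hk => ⟨(hφ k hk).2.continuousOn, (hφ k hk).2.isPiecewiseAffineOn⟩⟩
  · intro φ hφ lam hlam x0 hx0
    have hcon : ∀ k < N, net.AdmissibleState (net.closedLoop lam φ 0 x0 k) →
        net.Constraints k (lam k) (net.closedLoop lam φ 0 x0 k)
          (φ k (net.closedLoop lam φ 0 x0 k)) :=
      fun k hk hx => (hφ.constraints hk hx).of_zero_inflow (hlam k hk)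
    have hadm : ∀ k ≤ N, net.AdmissibleState (net.closedLoop lam φ 0 x0 k) := by
      intro k
      induction k with
      | zero => exact fun _ => hx0
      | succ k ih =>
        intro hk
        rw [net.closedLoop_succ lam φ (Nat.zero_le k)]
        exact (ih (by omega)).step (hcon k hk (ih (by omega)))
    exact ⟨rfl, fun j _ hj => ⟨net.closedLoop_succ lam φ (Nat.zero_le j) x0,
      hcon j hj (hadm j hj.le)⟩⟩
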